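/- A partition of size $n\ge 0$ is a set partition of $\{1,\dots,n\}$, written in canonical sequential form $\pi=\pi_1\pi_2\cdots\pi_n$: the blocks are numbered $1,2,\dots$ by increasing minima and $\pi_i$ is the number of the block of $i$ (the partition of size $0$ is the empty word). A partition $\pi$ contains a partition $\tau$ if $\pi$ has a subsequence order-isomorphic to $\tau$, and otherwise avoids $\tau$; a partition is non-crossing if it avoids $1212$. Two patterns $\alpha$ and $\beta$ are nc-equivalent if for every $n\ge 0$ the number of non-crossing partitions of size $n$ avoiding $\alpha$ equals the number of non-crossing partitions of size $n$ avoiding $\beta$. In a longer word, $[\sigma]$ stands for $\sigma$ with each letter increased by $k$, where $k$ is the number of distinct letters preceding it in the word; e.g. $1[112]1=12231$. A partition is connected if it cannot be written as $\alpha[\beta]$ with $\alpha,\beta$ nonempty partitions. **Theorem.** Let $\sigma$ and $\tau$ be two (possibly empty) connected partitions. Then the patterns $1[\sigma]1[\tau]$ and $1[\tau]1[\sigma]$ are nc-equivalent. -/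

import Mathlib

/-! Set partitions of `{1, …, n}` are represented by their canonical sequential forms: the word
`π₁ π₂ ⋯ πₙ` in which `πᵢ` is the index of the block of `i`, the blocks being numbered
`1, 2, …` by increasing minima. A word is a `List ℕ`. -/

namespace SetPart

/-- `w` is the canonical sequential form of a set partition (a restricted growth function):
each letter is positive and exceeds the maximum of the letters before it by at most `1`.
The empty word represents the empty partition. -/
def IsPartition (w : List ℕ) : Prop :=
  ∀ (u : List ℕ) (a : ℕ), u ++ [a] <+: w → 1 ≤ a ∧ a ≤ u.foldr max 0 + 1

/-- `π` contains `τ`: some subsequence of `π` is order-isomorphic to `τ`. -/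
def Contains (π τ : List ℕ) : Prop :=
  ∃ f : Fin τ.length → Fin π.length, StrictMono f ∧
    ∀ i j : Fin τ.length,
      (π.get (f i) < π.get (f j) ↔ τ.get i < τ.get j) ∧
      (π.get (f i) > π.get (f j) ↔ τ.get i > τ.get j)

/-- `π` avoids the pattern `τ`. -/
def Avoids (π τ : List ℕ) : Prop := ¬ Contains π τ

/-- The set of partitions of size `n` that avoid all the patterns in `T`. -/
def avoiders (n : ℕ) (T : Set (List ℕ)) : Set (List ℕ) :=
  {π | IsPartition π ∧ π.length = n ∧ ∀ τ ∈ T, Avoids π τ}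

/-- Wilf equivalence of two sets of patterns. -/
def WilfEquiv (T R : Set (List ℕ)) : Prop :=
  ∀ n : ℕ, (avoiders n T).ncard = (avoiders n R).ncard

/-- nc-equivalence: for each `n`, equally many non-crossing (that is, `1212`-avoiding) partitions
of size `n` avoid `σ` as avoid `τ`. -/
def NCEquiv (σ τ : List ℕ) : Prop :=
  WilfEquiv {[1, 2, 1, 2], σ} {[1, 2, 1, 2], τ}

/-- The word `α[β]`: the word `α` followed by `β + k`, where `k` is the number of
distinct letters of `α`. -/
def bracket (α β : List ℕ) : List ℕ := α ++ β.map (· + α.toFinset.card)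

/-- A partition is connected if it is not of the form `α[β]` with `α`, `β` nonempty partitions.
The empty partition is connected in this sense. -/
def Connected (π : List ℕ) : Prop :=
  ¬ ∃ α β : List ℕ, IsPartition α ∧ IsPartition β ∧ α ≠ [] ∧ β ≠ [] ∧ π = bracket α β

/-- The pattern `1[σ]1[τ]`. -/
def oneOne (σ τ : List ℕ) : List ℕ := bracket (bracket [1] σ ++ [1]) τ

theorem IsPartition.le_length {w : List ℕ} (h : IsPartition w) :
    ∀ a ∈ w, a ≤ w.length := by
  have key : w.foldr max 0 ≤ w.length := by
    induction w using List.reverseRecOn with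
    | nil => simp
    | append_singleton u a ih =>
      have hu := ih (fun v b hv => h v b (hv.trans (List.prefix_append u [a])))
      have ha := (h u a List.prefix_rfl).2
      have e : ∀ (l : List ℕ) (b : ℕ), l.foldr max b = max (l.foldr max 0) b := by
        intro l b
        induction l with
        | nil => simp
        | cons c l ihl => simp only [List.foldr_cons, ihl, max_assoc]
      rw [List.foldr_append, e]
      simp only [List.foldr_cons, List.foldr_nil, List.length_append, List.length_singleton]
      omega
  intro a ha
  refine le_trans ?_ key
  clear key h
  induction w with
  | nil => simp at ha
  | cons c l ih =>
    rcases List.mem_cons.1 ha with rfl | ha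
    · simp
    · exact (ih ha).trans (by simp)

/-- The cardinalities compared in `WilfEquiv` are those of finite sets. -/
theorem avoiders_finite (n : ℕ) (T : Set (List ℕ)) : (avoiders n T).Finite := by
  refine ((List.finite_length_eq (Fin (n + 1)) n).image (List.map Fin.val)).subset ?_
  rintro π ⟨hp, rfl, -⟩
  refine ⟨π.attach.map (fun a => ⟨a.1, Nat.lt_succ_of_le (hp.le_length a.1 a.2)⟩), by simp, ?_⟩
  simp [List.map_map, Function.comp_def]

end SetPart

/-! Cutting a nonempty non-crossing partition before each `1` writes it uniquely as
`1[w₁]1[w₂]⋯1[wₖ]` with every `wᵢ` non-crossing: a letter shared by two factors would cross the `1`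
between them (`NC.exists_join`, `join_inj`, `nc_join`). Distinct factors have disjoint letters, so
an occurrence of a connected pattern away from the `1`s lies inside one factor. Hence the partition
avoids `1[σ]1[τ]` iff every `wᵢ` avoids it and there are no `i < j` with `σ` in `wᵢ` and `τ` in `wⱼ`
(`join_avoids_iff`). Reversing the list of factors exchanges the roles of `σ` and `τ` in the
condition on pairs. The condition on single factors is handled by induction on size: each factor is
replaced by an equally long one avoiding `1[τ]1[σ]`, with the same answers to "contains `σ`?" and
"contains `τ`?". Such a replacement exists because partitions lacking `σ` or `τ` avoid both long
patterns and can stay fixed, so the inductive inequality passes to those containing both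
(`exists_injection`). This gives one inequality, and symmetry gives the other. -/

namespace SetPart

/-! ### Containment through increasing relabellings -/

/-- `s` is order-isomorphic to `τ`. -/
def Occ (s τ : List ℕ) : Prop := ∃ g : ℕ → ℕ, StrictMonoOn g {x | x ∈ τ} ∧ s = τ.map g

theorem contains_iff {π τ : List ℕ} : Contains π τ ↔ ∃ s, s.Sublist π ∧ Occ s τ := by
  constructor
  · rintro ⟨f, hf, h⟩
    have key : ∀ i j : Fin τ.length, τ.get i = τ.get j → π.get (f i) = π.get (f j) := by
      intro i j hij
      have h1 := (h i j).1
      have h2 := (h i j).2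
      omega
    -- The image of a letter is read off at its first position in `τ`; by `key` any other position
    -- gives the same value. The default `0` is never used.
    let g : ℕ → ℕ := fun x =>
      if hx : x ∈ τ then π.get (f ⟨τ.idxOf x, List.idxOf_lt_length_iff.2 hx⟩) else 0
    have hg : ∀ i : Fin τ.length, g (τ.get i) = π.get (f i) := by
      intro i
      have hi : τ.get i ∈ τ := List.get_mem τ i
      simp only [g, dif_pos hi]
      apply key
      simp
    refine ⟨τ.map g, ?_, g, ?_, rfl⟩
    · rw [List.sublist_iff_exists_fin_orderEmbedding_get_eq]
      refine ⟨(Fin.castOrderIso (by simp)).toOrderEmbedding.trans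
        (OrderEmbedding.ofStrictMono f hf), fun i => ?_⟩
      have := hg (Fin.cast (by simp) i)
      simpa using this
    · intro x hx y hy hxy
      obtain ⟨i, rfl⟩ := List.get_of_mem hx
      obtain ⟨j, rfl⟩ := List.get_of_mem hy
      rw [hg, hg]
      exact (h i j).1.2 hxy
  · rintro ⟨s, hs, g, hg, rfl⟩
    rw [List.sublist_iff_exists_fin_orderEmbedding_get_eq] at hs
    obtain ⟨F, hF⟩ := hs
    refine ⟨fun i => F (Fin.cast (by simp) i), fun i j hij => F.strictMono (by simpa using hij),
      fun i j => ?_⟩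
    have e : ∀ i : Fin τ.length, π.get (F (Fin.cast (by simp) i)) = g (τ.get i) := by
      intro i
      rw [← hF]
      simp
    simp only [e]
    exact ⟨hg.lt_iff_lt (List.get_mem τ i) (List.get_mem τ j),
      hg.lt_iff_lt (List.get_mem τ j) (List.get_mem τ i)⟩

theorem Occ.map {s τ : List ℕ} (h : Occ s τ) {f : ℕ → ℕ} (hf : StrictMonoOn f {x | x ∈ s}) :
    Occ (s.map f) τ := by
  obtain ⟨g, hg, rfl⟩ := h
  refine ⟨f ∘ g, fun x hx y hy hxy => hf ?_ ?_ (hg hx hy hxy), by simp⟩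
  · exact List.mem_map_of_mem hx
  · exact List.mem_map_of_mem hy

theorem Occ.of_map {s τ : List ℕ} {f : ℕ → ℕ} (hf : StrictMono f) (h : Occ (s.map f) τ) :
    Occ s τ := by
  obtain ⟨g, hg, e⟩ := h
  have hs : s = τ.map (Function.invFun f ∘ g) := by
    rw [← List.map_map, ← e, List.map_map, Function.invFun_comp hf.injective, List.map_id]
  have hfg : ∀ x ∈ τ, f (Function.invFun f (g x)) = g x := by
    intro x hx
    have : g x ∈ s.map f := e ▸ List.mem_map_of_mem hx
    obtain ⟨y, -, hy⟩ := List.mem_map.1 this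
    exact Function.invFun_eq ⟨y, hy⟩
  refine ⟨_, fun x hx y hy hxy => ?_, hs⟩
  rw [← hf.lt_iff_lt]
  simpa [hfg x hx, hfg y hy] using hg hx hy hxy

theorem Contains.of_sublist {π π' τ : List ℕ} (h : Contains π τ) (hs : π.Sublist π') :
    Contains π' τ := by
  rw [contains_iff] at *
  obtain ⟨s, h1, h2⟩ := h
  exact ⟨s, h1.trans hs, h2⟩

theorem contains_map_iff {f : ℕ → ℕ} (hf : StrictMono f) {π τ : List ℕ} :
    Contains (π.map f) τ ↔ Contains π τ := by
  simp only [contains_iff]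
  constructor
  · rintro ⟨s, h1, h2⟩
    obtain ⟨s', h3, rfl⟩ := List.sublist_map_iff.1 h1
    exact ⟨s', h3, h2.of_map hf⟩
  · rintro ⟨s, h1, h2⟩
    exact ⟨s.map f, h1.map f, h2.map (hf.strictMonoOn _)⟩

/-! ### Restricted growth functions -/

/-- The maximum letter of a word. -/
def top (w : List ℕ) : ℕ := w.foldr max 0

@[simp] theorem top_nil : top [] = 0 := rfl
@[simp] theorem top_cons (a : ℕ) (w : List ℕ) : top (a :: w) = max a (top w) := rfl
@[simp] theorem top_append (u v : List ℕ) : top (u ++ v) = max (top u) (top v) := by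
  induction u with
  | nil => simp
  | cons a u ih => simp [ih, max_assoc]

theorem le_top {w : List ℕ} {a : ℕ} (h : a ∈ w) : a ≤ top w := by
  induction w with
  | nil => simp at h
  | cons b w ih =>
    rcases List.mem_cons.1 h with rfl | h
    · simp
    · simp [ih h]

/-- `w` continues a restricted growth function with maximum `m`. -/
def Rgf : ℕ → List ℕ → Prop
  | _, [] => True
  | m, a :: w => (1 ≤ a ∧ a ≤ m + 1) ∧ Rgf (max m a) w

theorem rgf_append {m : ℕ} {u v : List ℕ} :
    Rgf m (u ++ v) ↔ Rgf m u ∧ Rgf (max m (top u)) v := by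
  induction u generalizing m with
  | nil => simp [Rgf]
  | cons a u ih => simp only [List.cons_append, Rgf, ih, top_cons, max_assoc, and_assoc]

theorem isPartition_iff {w : List ℕ} : IsPartition w ↔ Rgf 0 w := by
  induction w using List.reverseRecOn with
  | nil => simp [IsPartition, Rgf]
  | append_singleton w b ih =>
    rw [rgf_append, ← ih]
    constructor
    · intro h
      refine ⟨fun u a hu => h u a (hu.trans (List.prefix_append w [b])), ?_⟩
      have := h w b List.prefix_rfl
      change 1 ≤ b ∧ b ≤ top w + 1 at this
      simpa [Rgf] using this
    · rintro ⟨h1, h2⟩ u a hu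
      rcases List.prefix_concat_iff.1 hu with h | h
      · obtain ⟨rfl, e⟩ := List.append_inj' h rfl
        obtain rfl : a = b := by simpa using e
        change 1 ≤ a ∧ a ≤ top u + 1
        simpa [Rgf] using h2
      · exact h1 u a h

theorem Rgf.pos {m : ℕ} {w : List ℕ} (h : Rgf m w) {a : ℕ} (ha : a ∈ w) : 1 ≤ a := by
  induction w generalizing m with
  | nil => simp at ha
  | cons b w ih =>
    rcases List.mem_cons.1 ha with rfl | ha
    · exact h.1.1
    · exact ih h.2 ha

/-- The running maximum rises by at most one at a time, so no value is skipped. -/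
theorem Rgf.mem_of_le_top {m : ℕ} {w : List ℕ} (h : Rgf m w) {x : ℕ} (h1 : m < x)
    (h2 : x ≤ top w) : x ∈ w := by
  induction w generalizing m with
  | nil => simp at h2; omega
  | cons b w ih =>
    obtain ⟨⟨_, hb⟩, hw⟩ := h
    by_cases hx : x = b
    · simp [hx]
    · refine List.mem_cons_of_mem _ (ih hw (by omega) ?_)
      simp only [top_cons] at h2
      omega

theorem Rgf.le_card {w : List ℕ} (h : Rgf 0 w) {a : ℕ} (ha : a ∈ w) : a ≤ w.toFinset.card := by
  refine (le_top ha).trans ?_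
  have : Finset.Icc 1 (top w) ⊆ w.toFinset := by
    intro x hx
    rw [Finset.mem_Icc] at hx
    exact List.mem_toFinset.2 (h.mem_of_le_top hx.1 hx.2)
  simpa using Finset.card_le_card this

theorem Rgf.card_eq {w : List ℕ} (h : Rgf 0 w) : w.toFinset.card = top w := by
  have : w.toFinset = Finset.Icc 1 (top w) := by
    ext x
    rw [Finset.mem_Icc, List.mem_toFinset]
    exact ⟨fun hx => ⟨h.pos hx, le_top hx⟩, fun hx => h.mem_of_le_top hx.1 hx.2⟩
  rw [this]; simp

theorem Rgf.map_sub {m k : ℕ} {w : List ℕ} (h : Rgf (m + k) w) (hw : ∀ x ∈ w, k < x) :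
    Rgf m (w.map (· - k)) := by
  induction w generalizing m with
  | nil => simp [Rgf]
  | cons b w ih =>
    obtain ⟨⟨hb1, hb2⟩, h⟩ := h
    have hb := hw b (by simp)
    refine ⟨⟨by beta_reduce; omega, by beta_reduce; omega⟩,
      ih ?_ fun x hx => hw x (by simp [hx])⟩
    beta_reduce
    rwa [show max m (b - k) + k = max (m + k) b by omega]

/-! ### Connected patterns and the shape of occurrences -/

/-- Since `u` uses every letter up to `top u`, a `v` disjoint from it lies entirely above `top u`;
lowering `v` by `top u` would then exhibit `σ` as a bracket. -/
theorem Connected.exists_common {σ : List ℕ} (hσ : IsPartition σ) (hc : Connected σ)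
    {u v : List ℕ} (e : σ = u ++ v) (hu : u ≠ []) (hv : v ≠ []) : ∃ c, c ∈ u ∧ c ∈ v := by
  by_contra! hd
  rw [isPartition_iff] at hσ
  rw [e, rgf_append] at hσ
  obtain ⟨h1, h2⟩ := hσ
  have hk : ∀ x ∈ v, top u < x := by
    intro x hx
    by_contra! hle
    exact hd x (h1.mem_of_le_top (h2.pos hx) hle) hx
  apply hc
  refine ⟨u, v.map (· - top u), isPartition_iff.2 h1, isPartition_iff.2 (Rgf.map_sub (by simpa using h2) hk),
    hu, by simpa using hv, ?_⟩
  rw [bracket, h1.card_eq, e, List.map_map]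
  congr 1
  conv_lhs => rw [← List.map_id v]
  apply List.map_congr_left
  intro x hx
  have := hk x hx
  simp; omega

/-- A word that cannot be cut into two nonempty parts without a common letter. -/
def Linked (s : List ℕ) : Prop :=
  ∀ u v : List ℕ, s = u ++ v → u ≠ [] → v ≠ [] → ∃ c, c ∈ u ∧ c ∈ v

theorem Occ.linked {s τ : List ℕ} (h : Occ s τ) (hτ : Linked τ) : Linked s := by
  obtain ⟨g, hg, rfl⟩ := h
  intro u v e hu hv
  obtain ⟨u', v', rfl, rfl, rfl⟩ := List.map_eq_append_iff.1 e
  obtain ⟨c, h1, h2⟩ := hτ u' v' rfl (by simpa using hu) (by simpa using hv)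
  exact ⟨g c, List.mem_map_of_mem h1, List.mem_map_of_mem h2⟩

theorem occ_cons_iff {s τ : List ℕ} (hτ : IsPartition τ) :
    Occ s (bracket [1] τ) ↔ ∃ a t, s = a :: t ∧ (∀ x ∈ t, a < x) ∧ Occ t τ := by
  rw [isPartition_iff] at hτ
  constructor
  · rintro ⟨g, hg, rfl⟩
    refine ⟨g 1, (τ.map (· + 1)).map g, by simp [bracket], ?_, ?_⟩
    · intro x hx
      obtain ⟨y, hy, rfl⟩ := List.mem_map.1 hx
      obtain ⟨z, hz, rfl⟩ := List.mem_map.1 hy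
      have := hτ.pos hz
      exact hg (by simp [bracket]) (by simp [bracket, hz]) (by omega)
    · refine ⟨g ∘ (· + 1), fun x hx y hy hxy => ?_, by simp⟩
      simp only [Set.mem_ofPred_eq] at hx hy
      exact hg (by simp [bracket, hx]) (by simp [bracket, hy]) (by simpa using hxy)
  · rintro ⟨a, t, rfl, ha, g, hg, rfl⟩
    refine ⟨fun x => if x = 1 then a else g (x - 1), ?_, ?_⟩
    · intro x hx y hy hxy
      simp only [bracket, Set.mem_ofPred_eq, List.mem_append, List.mem_map, List.mem_singleton,
        List.toFinset_cons, List.toFinset_nil, insert_empty_eq, Finset.card_singleton] at hx hy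
      rcases hx with rfl | ⟨x, hx, rfl⟩ <;> rcases hy with rfl | ⟨y, hy, rfl⟩
      · omega
      · have := hτ.pos hy
        simpa [show y ≠ 0 by omega] using ha _ (List.mem_map_of_mem hy)
      · omega
      · have := hτ.pos hy
        have := hτ.pos hx
        simpa [show y ≠ 0 by omega, show x ≠ 0 by omega] using hg hx hy (by omega)
    · simp only [bracket, List.singleton_append, List.map_cons, List.map_map, if_true,
        List.cons.injEq, true_and]
      apply List.map_congr_left
      intro x hx
      have := hτ.pos hx
      simp [show x ≠ 0 by omega]

theorem occ_oneOne_iff {s σ τ : List ℕ} (hσ : IsPartition σ) (hτ : IsPartition τ) :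
    Occ s (oneOne σ τ) ↔ ∃ a u t, s = a :: (u ++ a :: t) ∧ (∀ x ∈ u, a < x) ∧ (∀ x ∈ t, a < x) ∧
      (∀ x ∈ u, ∀ y ∈ t, x < y) ∧ Occ u σ ∧ Occ t τ := by
  rw [isPartition_iff] at hσ hτ
  obtain ⟨k, hk, hkσ⟩ : ∃ k, oneOne σ τ = 1 :: (σ.map (· + 1) ++ 1 :: τ.map (· + (k + 1))) ∧
      ∀ x ∈ σ, x ≤ k := by
    -- The prefix `1[σ]1` has one more distinct letter than `σ`, hence the shift `k + 1` on `τ`.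
    refine ⟨σ.toFinset.card, ?_, fun x hx => hσ.le_card hx⟩
    have : (1 :: (σ.map (· + 1) ++ [1])).toFinset.card = σ.toFinset.card + 1 := by
      have e : (1 :: (σ.map (· + 1) ++ [1])).toFinset = insert 1 (σ.toFinset.image (· + 1)) := by
        ext x; simp
      rw [e, Finset.card_insert_of_notMem, Finset.card_image_of_injective _ (add_left_injective 1)]
      simp only [Finset.mem_image, List.mem_toFinset, not_exists, not_and]
      intro x hx
      have := hσ.pos hx
      omega
    have e : oneOne σ τ = (1 :: (σ.map (· + 1) ++ [1])) ++
        τ.map (· + (1 :: (σ.map (· + 1) ++ [1])).toFinset.card) := rfl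
    rw [e, this]
    simp
  rw [hk]
  constructor
  · rintro ⟨g, hg, rfl⟩
    have m1 : 1 ∈ {x | x ∈ 1 :: (σ.map (· + 1) ++ 1 :: τ.map (· + (k + 1)))} := by simp
    have m2 : ∀ x ∈ σ, x + 1 ∈ {x | x ∈ 1 :: (σ.map (· + 1) ++ 1 :: τ.map (· + (k + 1)))} := by
      intro x hx; simp [hx]
    have m3 : ∀ x ∈ τ,
        x + (k + 1) ∈ {x | x ∈ 1 :: (σ.map (· + 1) ++ 1 :: τ.map (· + (k + 1)))} := by
      intro x hx; simp [hx]
    refine ⟨g 1, (σ.map (· + 1)).map g, (τ.map (· + (k + 1))).map g, by simp, ?_, ?_, ?_,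
      ⟨g ∘ (· + 1), ?_, by simp⟩, ⟨g ∘ (· + (k + 1)), ?_, by simp⟩⟩
    · simp only [List.map_map, List.mem_map, forall_exists_index, and_imp]
      rintro _ x hx rfl
      have := hσ.pos hx
      exact hg m1 (m2 x hx) (by beta_reduce; omega)
    · simp only [List.map_map, List.mem_map, forall_exists_index, and_imp]
      rintro _ x hx rfl
      have := hτ.pos hx
      exact hg m1 (m3 x hx) (by beta_reduce; omega)
    · simp only [List.map_map, List.mem_map, forall_exists_index, and_imp]
      rintro _ x hx rfl _ y hy rfl
      have := hτ.pos hy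
      have := hkσ x hx
      exact hg (m2 x hx) (m3 y hy) (by beta_reduce; omega)
    · intro x hx y hy hxy
      exact hg (m2 x hx) (m2 y hy) (by beta_reduce; omega)
    · intro x hx y hy hxy
      exact hg (m3 x hx) (m3 y hy) (by beta_reduce; omega)
  · rintro ⟨a, u, t, rfl, hu, ht, hut, ⟨g, hg, rfl⟩, ⟨h, hh, rfl⟩⟩
    let F : ℕ → ℕ := fun x => if x = 1 then a else if x ≤ k + 1 then g (x - 1) else h (x - (k + 1))
    have F1 : F 1 = a := by simp [F]
    have F2 : ∀ x ∈ σ, F (x + 1) = g x := by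
      intro x hx
      have := hσ.pos hx
      have := hkσ x hx
      simp [F, show x ≠ 0 by omega, this]
    have F3 : ∀ x ∈ τ, F (x + (k + 1)) = h x := by
      intro x hx
      have := hτ.pos hx
      simp only [F]
      rw [if_neg (by omega), if_neg (by omega), Nat.add_sub_cancel]
    refine ⟨F, ?_, ?_⟩
    · have cases : ∀ x, x ∈ 1 :: (σ.map (· + 1) ++ 1 :: τ.map (· + (k + 1))) →
          x = 1 ∨ (∃ z ∈ σ, z + 1 = x) ∨ ∃ z ∈ τ, z + (k + 1) = x := by
        intro x hx
        simp only [List.mem_cons, List.mem_append, List.mem_map] at hx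
        rcases hx with h | h | h | h
        exacts [Or.inl h, Or.inr (Or.inl h), Or.inl h, Or.inr (Or.inr h)]
      intro x hx₀ y hy₀ hxy
      rcases cases x hx₀ with rfl | ⟨x, hx, rfl⟩ | ⟨x, hx, rfl⟩ <;>
        rcases cases y hy₀ with rfl | ⟨y, hy, rfl⟩ | ⟨y, hy, rfl⟩
      · omega
      · rw [F1, F2 y hy]; exact hu _ (List.mem_map_of_mem hy)
      · rw [F1, F3 y hy]; exact ht _ (List.mem_map_of_mem hy)
      · have := hσ.pos hx
        omega
      · rw [F2 x hx, F2 y hy]; exact hg hx hy (by omega)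
      · rw [F2 x hx, F3 y hy]; exact hut _ (List.mem_map_of_mem hx) _ (List.mem_map_of_mem hy)
      · have := hτ.pos hx
        omega
      · have := hτ.pos hx
        have := hkσ y hy
        omega
      · rw [F3 x hx, F3 y hy]; exact hh hx hy (by omega)
    · have e1 : σ.map (F ∘ (· + 1)) = σ.map g := List.map_congr_left F2
      have e2 : τ.map (F ∘ (· + (k + 1))) = τ.map h := List.map_congr_left F3
      simp [F1, e1, e2]

/-! ### Gluing `1[w]` to a remainder -/

/-- Shifts the letters greater than `1` by `m`. -/
def sh (m x : ℕ) : ℕ := if x ≤ 1 then x else x + m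

theorem sh_strictMono (m : ℕ) : StrictMono (sh m) := by
  intro x y h
  simp only [sh]
  split_ifs <;> omega

/-- The word `1[w]` followed by `r` with its letters greater than `1` made greater than
those of `1[w]`. -/
def glue (w r : List ℕ) : List ℕ := 1 :: (w.map (· + 1) ++ r.map (sh (top w)))

theorem glue_disjoint {w r : List ℕ} (hw : Rgf 0 w) {x : ℕ} (h1 : x ∈ w.map (· + 1))
    (h2 : x ∈ r.map (sh (top w))) : False := by
  obtain ⟨y, hy, rfl⟩ := List.mem_map.1 h1
  obtain ⟨z, -, e⟩ := List.mem_map.1 h2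
  have := hw.pos hy
  have := le_top hy
  simp only [sh] at e
  split_ifs at e <;> omega

theorem glue_lt {w r : List ℕ} {x y : ℕ} (h1 : x ∈ w.map (· + 1))
    (h2 : y ∈ r.map (sh (top w))) (hy : 1 < y) : x < y := by
  obtain ⟨x, hx, rfl⟩ := List.mem_map.1 h1
  obtain ⟨z, -, rfl⟩ := List.mem_map.1 h2
  have := le_top hx
  simp only [sh] at *
  split_ifs at * <;> omega

theorem one_lt_of_mem {w : List ℕ} (hw : Rgf 0 w) {x : ℕ} (h : x ∈ w.map (· + 1)) : 1 < x := by
  obtain ⟨y, hy, rfl⟩ := List.mem_map.1 h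
  have := hw.pos hy
  omega

theorem Rgf.eq_cons {r : List ℕ} (hr : Rgf 0 r) (h : r ≠ []) : ∃ r', r = 1 :: r' ∧ Rgf 1 r' := by
  cases r with
  | nil => simp at h
  | cons a r =>
    obtain ⟨ha, hr⟩ := hr
    obtain rfl : a = 1 := by omega
    exact ⟨r, rfl, by simpa using hr⟩

theorem sh_one (m : ℕ) : sh m 1 = 1 := rfl

/-- The word starts with `1`, and a subsequence beginning with another letter leaves that `1` free.
-/
theorem Rgf.one_cons_sublist {r : List ℕ} (hr : Rgf 0 r) {f : ℕ → ℕ} (hf : f 1 = 1) {b : ℕ}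
    {s : List ℕ} (hs : (b :: s).Sublist (r.map f)) (hb : b ≠ 1) :
    (1 :: b :: s).Sublist (r.map f) := by
  obtain ⟨r', rfl, -⟩ := hr.eq_cons (by rintro rfl; simp at hs)
  rw [List.map_cons, hf] at hs ⊢
  rcases List.sublist_cons_iff.1 hs with h | ⟨_, h, -⟩
  · exact h.cons_cons 1
  · simp [hb] at h

/-- The linked part `q` cannot straddle two words with disjoint letters; only the tail `t` may be
cut. -/
theorem Linked.sublist_append {q t u v : List ℕ} (hq : Linked q)
    (hd : ∀ x ∈ u, x ∉ v) (h : (q ++ t).Sublist (u ++ v)) :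
    (q ++ t).Sublist v ∨ ∃ t₁ t₂, t = t₁ ++ t₂ ∧ (q ++ t₁).Sublist u ∧ t₂.Sublist v := by
  obtain ⟨s₁, s₂, e, h1, h2⟩ := List.sublist_append_iff.1 h
  rcases List.append_eq_append_iff.1 e with ⟨z, rfl, rfl⟩ | ⟨z, rfl, rfl⟩
  · exact Or.inr ⟨z, s₂, rfl, h1, h2⟩
  · by_cases hz : z = []
    · subst hz
      exact Or.inr ⟨[], t, rfl, by simpa using h1, by simpa using h2⟩
    by_cases hs : s₁ = []
    · subst hs
      exact Or.inl (by simpa using h2)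
    obtain ⟨c, h3, h4⟩ := hq _ _ rfl hs hz
    exact absurd (h2.subset (List.mem_append_left _ h4)) (hd c (h1.subset h3))

theorem Linked.sublist_or {q u v : List ℕ} (hq : Linked q)
    (hd : ∀ x ∈ u, x ∉ v) (h : q.Sublist (u ++ v)) : q.Sublist v ∨ q.Sublist u := by
  rcases hq.sublist_append hd (t := []) (by simpa using h) with h | ⟨t₁, t₂, e, h, -⟩
  · exact Or.inl (by simpa using h)
  · obtain ⟨rfl, rfl⟩ := List.append_eq_nil_iff.1 e.symm
    exact Or.inr (by simpa using h)

theorem linked_pair (a : ℕ) (u : List ℕ) : Linked (a :: (u ++ [a])) := by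
  intro p q e hp hq
  refine ⟨a, ?_, ?_⟩
  · cases p with
    | nil => simp at hp
    | cons b p => simp only [List.cons_append, List.cons.injEq] at e; simp [e.1]
  · rcases List.eq_nil_or_concat q with rfl | ⟨q, b, rfl⟩
    · simp at hq
    · have := congrArg List.getLast? e
      rw [List.concat_eq_append, ← List.append_assoc, ← List.cons_append, List.getLast?_append,
        List.getLast?_append] at this
      simp only [List.getLast?_singleton, Option.some_or, Option.some.injEq] at this
      simp [this]

theorem left_sublist_glue (w r : List ℕ) : (w.map (· + 1)).Sublist (glue w r) :=
  (List.sublist_append_left _ _).trans (List.sublist_cons_self _ _)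

theorem right_sublist_glue (w r : List ℕ) : (r.map (sh (top w))).Sublist (glue w r) :=
  (List.sublist_append_right _ _).trans (List.sublist_cons_self _ _)

theorem Contains.glue_left {w τ : List ℕ} (h : Contains w τ) (r : List ℕ) :
    Contains (glue w r) τ :=
  ((contains_map_iff (fun _ _ h => Nat.add_lt_add_right h 1)).2 h).of_sublist
    (left_sublist_glue w r)

theorem Contains.glue_right {r τ : List ℕ} (h : Contains r τ) (w : List ℕ) :
    Contains (glue w r) τ :=
  ((contains_map_iff (sh_strictMono _)).2 h).of_sublist (right_sublist_glue w r)

theorem contains_of_left {w s τ : List ℕ} (hs : s.Sublist (w.map (· + 1))) (h : Occ s τ) :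
    Contains w τ :=
  (contains_map_iff (fun _ _ h => Nat.add_lt_add_right h 1)).1 (contains_iff.2 ⟨s, hs, h⟩)

theorem contains_of_right {m : ℕ} {r s τ : List ℕ} (hs : s.Sublist (r.map (sh m))) (h : Occ s τ) :
    Contains r τ :=
  (contains_map_iff (sh_strictMono m)).1 (contains_iff.2 ⟨s, hs, h⟩)

theorem Rgf.contains_one {m : ℕ} {r t τ : List ℕ} (hτ : IsPartition τ) (hr : Rgf 0 r) (h0 : r ≠ [])
    (ht : t.Sublist (r.map (sh m))) (h1 : ∀ x ∈ t, 1 < x) (h : Occ t τ) :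
    Contains r (bracket [1] τ) := by
  refine contains_of_right (m := m) (s := 1 :: t) ?_ ((occ_cons_iff hτ).2 ⟨1, t, rfl, h1, h⟩)
  cases t with
  | nil =>
    obtain ⟨r', rfl, -⟩ := hr.eq_cons h0
    simp [sh_one]
  | cons b t =>
    have := h1 b (by simp)
    exact hr.one_cons_sublist (sh_one m) ht (by omega)

theorem glue_pos {w r : List ℕ} (hr : Rgf 0 r) {x : ℕ} (h : x ∈ glue w r) : 1 ≤ x := by
  simp only [glue, List.mem_cons, List.mem_append, List.mem_map] at h
  rcases h with rfl | ⟨y, -, rfl⟩ | ⟨y, hy, rfl⟩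
  · omega
  · omega
  · have := hr.pos hy
    simp only [sh]
    split_ifs <;> omega

/-! ### Containment in a glued word -/

theorem glue_contains_cons_iff {τ w r : List ℕ} (hτ : IsPartition τ) (hc : Linked τ)
    (hw : Rgf 0 w) (hr : Rgf 0 r) :
    Contains (glue w r) (bracket [1] τ) ↔ Contains w τ ∨ Contains r (bracket [1] τ) := by
  constructor
  · intro h
    obtain ⟨s, hs, ho⟩ := contains_iff.1 h
    obtain ⟨a, t, rfl, ha, ht⟩ := (occ_cons_iff hτ).1 ho
    have ha1 : 1 ≤ a := glue_pos hr (hs.subset (by simp))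
    have hs' : t.Sublist (w.map (· + 1) ++ r.map (sh (top w))) := by simpa [glue] using hs.tail
    -- For empty `τ` the remainder `r` may be empty too, so containment is charged to `w`.
    by_cases ht0 : t = []
    · subst ht0
      exact Or.inl (contains_of_left (List.nil_sublist _) ht)
    rcases (ht.linked hc).sublist_or (fun x h1 h2 => glue_disjoint hw h1 h2) hs' with h | h
    · refine Or.inr (hr.contains_one hτ ?_ h (fun x hx => ha1.trans_lt (ha x hx)) ht)
      rintro rfl
      exact ht0 (by simpa using h)
    · exact Or.inl (contains_of_left h ht)
  · rintro (h | h)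
    · obtain ⟨s, hs, ho⟩ := contains_iff.1 h
      refine contains_iff.2 ⟨1 :: s.map (· + 1), ?_, (occ_cons_iff hτ).2 ⟨1, s.map (· + 1), rfl,
        ?_, ho.map fun _ _ _ _ h => Nat.add_lt_add_right h 1⟩⟩
      · exact ((hs.map _).trans (List.sublist_append_left _ _)).cons_cons 1
      · intro x hx
        exact one_lt_of_mem hw ((hs.map _).subset hx)
    · exact h.glue_right w

/-- The mixed case is `σ` found in `w` after the leading `1`, then a `1` of `r` followed by `τ`.
Conversely, an occurrence `a u a t` with `a = 1` has its second `a` in `r`, and one with `a > 1` has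
`a u a` on one side. -/
theorem glue_contains_oneOne_iff {σ τ w r : List ℕ} (hσ : IsPartition σ) (hτ : IsPartition τ)
    (hσc : Linked σ) (hτc : Linked τ) (hw : Rgf 0 w) (hr : Rgf 0 r) :
    Contains (glue w r) (oneOne σ τ) ↔ Contains w (oneOne σ τ) ∨ Contains r (oneOne σ τ) ∨
      (Contains w σ ∧ Contains r (bracket [1] τ)) := by
  have hd : ∀ x ∈ w.map (· + 1), x ∉ r.map (sh (top w)) := fun x h1 h2 => glue_disjoint hw h1 h2
  constructor
  · intro h
    obtain ⟨s, hs, ho⟩ := contains_iff.1 h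
    obtain ⟨a, u, t, rfl, hu, ht, hut, hou, hot⟩ := (occ_oneOne_iff hσ hτ).1 ho
    have ha1 : 1 ≤ a := glue_pos hr (hs.subset (by simp))
    have hu1 : ∀ x ∈ u, 1 < x := fun x hx => ha1.trans_lt (hu x hx)
    have ht1 : ∀ x ∈ t, 1 < x := fun x hx => ha1.trans_lt (ht x hx)
    rcases ha1.eq_or_lt with rfl | ha2
    · have hs' : (u ++ 1 :: t).Sublist (w.map (· + 1) ++ r.map (sh (top w))) := by
        simpa [glue] using hs.tail
      have right : ∀ (_ : (1 :: t).Sublist (r.map (sh (top w)))) (_ : Contains w σ),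
          Contains w σ ∧ Contains r (bracket [1] τ) := fun h1 h2 =>
        ⟨h2, contains_of_right h1 ((occ_cons_iff hτ).2 ⟨1, t, rfl, ht1, hot⟩)⟩
      -- If `u` is nonempty and on the right, the initial `1` of `r` replaces the leading one. If
      -- `u` is on the left, the cut comes right after it, because the shifted `w` has no `1`.
      rcases (hou.linked hσc).sublist_append hd hs' with h | ⟨t₁, t₂, e, h1, h2⟩
      · cases u with
        | nil => exact Or.inr (Or.inr (right h (contains_of_left (List.nil_sublist _) hou)))
        | cons b u =>
          have := hu1 b (by simp)
          exact Or.inr (Or.inl (contains_of_right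
            (hr.one_cons_sublist (sh_one _) h (by omega)) ho))
      · cases t₁ with
        | nil =>
          obtain rfl : t₂ = 1 :: t := by simpa using e.symm
          exact Or.inr (Or.inr (right h2 (contains_of_left (by simpa using h1) hou)))
        | cons b t₁ =>
          obtain ⟨rfl, -⟩ : 1 = b ∧ _ := by simpa using e
          have := one_lt_of_mem hw (h1.subset (List.mem_append_right u (List.mem_cons_self (a := 1))))
          omega
    · have hs' : ((a :: (u ++ [a])) ++ t).Sublist (w.map (· + 1) ++ r.map (sh (top w))) := by
        rcases List.sublist_cons_iff.1 hs with h | ⟨_, h, -⟩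
        · simpa using h
        · simp at h; omega
      have e : a :: (u ++ [a]) ++ t = a :: (u ++ a :: t) := by simp
      rcases (linked_pair a u).sublist_append hd hs' with h | ⟨t₁, t₂, rfl, h1, h2⟩
      · exact Or.inr (Or.inl (contains_of_right (e ▸ h) ho))
      · by_cases h3 : t₂ = []
        · subst h3
          rw [List.append_nil] at *
          exact Or.inl (contains_of_left (e ▸ h1) ho)
        by_cases h4 : t₁ = []
        · subst h4
          rw [List.append_nil] at h1
          -- With `t` wholly on the right, the first `1` of `r` takes over the role of the repeated
          -- letter `a`.
          refine Or.inr (Or.inr ⟨contains_of_left (List.Sublist.trans ?_ h1) hou,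
            hr.contains_one hτ ?_ h2 ht1 hot⟩)
          · exact (List.sublist_append_left _ _).trans (List.sublist_cons_self _ _)
          · rintro rfl
            exact h3 (by simpa using h2)
        obtain ⟨c, h5, h6⟩ := hot.linked hτc _ _ rfl h4 h3
        exact absurd (h2.subset h6) (hd c (h1.subset (List.mem_append_right _ h5)))
  · rintro (h | h | ⟨h, h'⟩)
    · exact h.glue_left r
    · exact h.glue_right w
    · obtain ⟨u, hu, hou⟩ := contains_iff.1 h
      obtain ⟨s, hs, hos⟩ := contains_iff.1 h'
      obtain ⟨b, t, rfl, hb, hot⟩ := (occ_cons_iff hτ).1 hos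
      obtain ⟨r', rfl, -⟩ := hr.eq_cons (by rintro rfl; simp at hs)
      have hts : t.Sublist r' := by simpa using hs.tail
      have hb1 : 1 ≤ b := hr.pos (hs.subset (by simp))
      have e1 : (u.map (· + 1)).Sublist (w.map (· + 1)) := hu.map _
      have e2 : (t.map (sh (top w))).Sublist ((1 :: r').map (sh (top w))) :=
        (hts.map _).trans (List.sublist_cons_self _ _)
      have ht1 : ∀ x ∈ t.map (sh (top w)), 1 < x := by
        intro x hx
        obtain ⟨y, hy, rfl⟩ := List.mem_map.1 hx
        have := hb y hy
        simp only [sh]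
        split_ifs <;> omega
      refine contains_iff.2 ⟨1 :: (u.map (· + 1) ++ 1 :: t.map (sh (top w))), ?_,
        (occ_oneOne_iff hσ hτ).2 ⟨1, _, _, rfl, fun x hx => one_lt_of_mem hw (e1.subset hx), ht1,
          fun x hx y hy => glue_lt (e1.subset hx) (e2.subset hy) (ht1 y hy),
          hou.map fun _ _ _ _ h => Nat.add_lt_add_right h 1,
          hot.map ((sh_strictMono _).strictMonoOn _)⟩⟩
      refine List.Sublist.cons_cons 1 (e1.append ?_)
      exact (hts.map _).cons_cons 1

/-- Contrapositively, a word lacking `σ` or `τ` avoids both `1[σ]1[τ]` and `1[τ]1[σ]`. -/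
theorem contains_of_oneOne {π σ τ : List ℕ} (hσ : IsPartition σ) (hτ : IsPartition τ)
    (h : Contains π (oneOne σ τ)) : Contains π σ ∧ Contains π τ := by
  obtain ⟨s, hs, ho⟩ := contains_iff.1 h
  obtain ⟨a, u, t, rfl, -, -, -, hu, ht⟩ := (occ_oneOne_iff hσ hτ).1 ho
  refine ⟨contains_iff.2 ⟨u, List.Sublist.trans ?_ hs, hu⟩,
    contains_iff.2 ⟨t, List.Sublist.trans ?_ hs, ht⟩⟩
  · exact (List.sublist_append_left _ _).trans (List.sublist_cons_self _ _)
  · exact (List.sublist_cons_self a t).trans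
      ((List.sublist_append_right _ _).trans (List.sublist_cons_self _ _))

/-! ### Unique decomposition of non-crossing partitions -/

/-- Non-crossing partitions. -/
def NC (w : List ℕ) : Prop := Rgf 0 w ∧ ∀ a b, a < b → ¬ [a, b, a, b].Sublist w

theorem contains_crossing_iff {w : List ℕ} :
    Contains w [1, 2, 1, 2] ↔ ∃ a b, a < b ∧ [a, b, a, b].Sublist w := by
  rw [contains_iff]
  constructor
  · rintro ⟨_, hs, g, hg, rfl⟩
    exact ⟨g 1, g 2, hg (by simp) (by simp) (by omega), by simpa using hs⟩
  · rintro ⟨a, b, hab, hs⟩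
    refine ⟨_, hs, fun x => if x = 1 then a else b, ?_, by simp⟩
    intro x hx y hy hxy
    have hx' : x = 1 ∨ x = 2 := by
      simp only [Set.mem_ofPred_eq, List.mem_cons, List.not_mem_nil] at hx
      tauto
    have hy' : y = 1 ∨ y = 2 := by
      simp only [Set.mem_ofPred_eq, List.mem_cons, List.not_mem_nil] at hy
      tauto
    rcases hx' with rfl | rfl <;> rcases hy' with rfl | rfl <;> first | omega | simpa using hab

theorem mem_avoiders_iff {n : ℕ} {π ρ : List ℕ} :
    π ∈ avoiders n {[1, 2, 1, 2], ρ} ↔ NC π ∧ π.length = n ∧ ¬ Contains π ρ := by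
  simp only [avoiders, Set.mem_ofPred_eq, Set.mem_insert_iff, Set.mem_singleton_iff,
    forall_eq_or_imp, forall_eq, Avoids, NC, isPartition_iff, contains_crossing_iff]
  push Not
  tauto

theorem rgf_map_sh {m j : ℕ} {r : List ℕ} (hj : 1 ≤ j) :
    Rgf (j + m) (r.map (sh m)) ↔ Rgf j r := by
  induction r generalizing j with
  | nil => simp [Rgf]
  | cons a r ih =>
    have e : max (j + m) (sh m a) = max j a + m := by
      simp only [sh]; split_ifs <;> omega
    have e' : (1 ≤ sh m a ∧ sh m a ≤ j + m + 1) ↔ 1 ≤ a ∧ a ≤ j + 1 := by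
      simp only [sh]; split_ifs <;> omega
    simp only [List.map_cons, Rgf, e, e', ih (show 1 ≤ max j a by omega)]

theorem rgf_map_add {m k : ℕ} {w : List ℕ} (h : Rgf m w) : Rgf (m + k) (w.map (· + k)) := by
  induction w generalizing m with
  | nil => simp [Rgf]
  | cons a w ih =>
    obtain ⟨⟨h1, h2⟩, h⟩ := h
    refine ⟨⟨by beta_reduce; omega, by beta_reduce; omega⟩, ?_⟩
    beta_reduce
    rw [show max (m + k) (a + k) = max m a + k by omega]
    exact ih h

theorem max_one_top_map (w : List ℕ) : max 1 (top (w.map (· + 1))) = top w + 1 := by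
  induction w with
  | nil => simp
  | cons a w ih => simp only [List.map_cons, top_cons]; omega

theorem rgf_map_sh_zero {m : ℕ} {r : List ℕ} (hr : Rgf 0 r) : Rgf (m + 1) (r.map (sh m)) := by
  cases r with
  | nil => trivial
  | cons a r =>
    obtain ⟨_, h, h'⟩ := hr.eq_cons (by simp)
    obtain ⟨rfl, rfl⟩ := List.cons.inj h
    refine ⟨by simp [sh_one], ?_⟩
    rw [sh_one, max_eq_left (by omega), add_comm m 1]
    exact (rgf_map_sh le_rfl).2 h'

theorem rgf_glue {w r : List ℕ} (hw : Rgf 0 w) (hr : Rgf 0 r) : Rgf 0 (glue w r) := by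
  refine ⟨by omega, ?_⟩
  rw [Nat.zero_max, rgf_append, max_one_top_map]
  have h := rgf_map_add (k := 1) hw
  rw [zero_add] at h
  exact ⟨h, rgf_map_sh_zero hr⟩

theorem NC.of_map {w π : List ℕ} {f : ℕ → ℕ} (hf : StrictMono f) (hw : Rgf 0 w) (hπ : NC π)
    (h : (w.map f).Sublist π) : NC w :=
  ⟨hw, fun a b hab hs => hπ.2 (f a) (f b) (hf hab) ((hs.map f).trans h)⟩

theorem not_sublist_map {f : ℕ → ℕ} (hf : StrictMono f) {w : List ℕ} (hw : NC w) {a b : ℕ}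
    (hab : a < b) : ¬ [a, b, a, b].Sublist (w.map f) := by
  intro h
  obtain ⟨s, hs, e⟩ := List.sublist_map_iff.1 h
  rcases s with _ | ⟨x, _ | ⟨y, _ | ⟨z, _ | ⟨t, _ | ⟨v, s⟩⟩⟩⟩⟩ <;>
    simp only [List.map_cons, List.map_nil, List.cons.injEq, reduceCtorEq, and_true,
      and_false] at e
  obtain ⟨rfl, rfl, h1, h2⟩ := e
  obtain rfl := hf.injective h1
  obtain rfl := hf.injective h2
  exact hw.2 x y (hf.lt_iff_lt.1 hab) hs

theorem linked_crossing (a b : ℕ) : Linked [a, b, a, b] := by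
  intro u v e hu hv
  rcases u with _ | ⟨x, _ | ⟨y, _ | ⟨z, u⟩⟩⟩
  · simp at hu
  · simp only [List.cons_append, List.nil_append, List.cons.injEq] at e
    exact ⟨a, by simp [e.1], by simp [← e.2]⟩
  · simp only [List.cons_append, List.nil_append, List.cons.injEq] at e
    exact ⟨a, by simp [e.1], by simp [← e.2.2]⟩
  · simp only [List.cons_append, List.cons.injEq] at e
    obtain ⟨rfl, rfl, rfl, e⟩ := e
    refine ⟨b, by simp, ?_⟩
    cases u with
    | nil => simp at e; simp [← e]
    | cons c u => simp [hv] at e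

/-- A crossing that avoids the leading `1` is linked, so it lies on one side. One that uses it
leaves `b 1 b`, which must lie in `r`, where the initial `1` of `r` completes a crossing. -/
theorem nc_glue {w r : List ℕ} (hw : NC w) (hr : NC r) : NC (glue w r) := by
  refine ⟨rgf_glue hw.1 hr.1, fun a b hab h => ?_⟩
  have hd : ∀ x ∈ w.map (· + 1), x ∉ r.map (sh (top w)) :=
    fun x h1 h2 => glue_disjoint hw.1 h1 h2
  have key : ¬ [a, b, a, b].Sublist (w.map (· + 1) ++ r.map (sh (top w))) := by
    intro h
    rcases (linked_crossing a b).sublist_or hd h with h | h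
    · exact not_sublist_map (sh_strictMono _) hr hab h
    · exact not_sublist_map (fun _ _ h => Nat.add_lt_add_right h 1) hw hab h
  rcases List.sublist_cons_iff.1 h with h | ⟨s, e, h⟩
  · exact key h
  · obtain ⟨rfl, rfl⟩ := List.cons.inj e
    have hl : Linked [b, 1, b] := linked_pair b [1]
    rcases hl.sublist_or hd h with h | h
    · exact not_sublist_map (sh_strictMono _) hr hab
        (hr.1.one_cons_sublist (sh_one _) h (by omega))
    · have := one_lt_of_mem hw.1 (h.subset (show 1 ∈ [b, 1, b] by simp))
      omega

theorem NC.exists_glue {π : List ℕ} (hπ : NC π) (h0 : π ≠ []) :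
    ∃ w r, NC w ∧ NC r ∧ π = glue w r := by
  obtain ⟨π', rfl, hp⟩ := hπ.1.eq_cons h0
  -- The cut is made just before the second `1`, if there is one.
  obtain ⟨u, R, rfl, hu, hR⟩ : ∃ u R, π' = u ++ R ∧ (∀ x ∈ u, x ≠ 1) ∧
      (R = [] ∨ ∃ R', R = 1 :: R') := by
    refine ⟨π'.takeWhile (· ≠ 1), π'.dropWhile (· ≠ 1), List.takeWhile_append_dropWhile.symm,
      fun x hx => by simpa using List.mem_takeWhile_imp hx, ?_⟩
    cases h : π'.dropWhile (· ≠ 1) with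
    | nil => exact Or.inl rfl
    | cons a R' =>
      have := List.head_dropWhile_not (fun x => decide (x ≠ 1)) (l := π')
        (by rw [h]; simp)
      simp only [h, List.head_cons] at this
      obtain rfl : a = 1 := by simpa using this
      exact Or.inr ⟨R', rfl⟩
  rw [rgf_append] at hp
  obtain ⟨w, rfl, hw⟩ : ∃ w, u = w.map (· + 1) ∧ Rgf 0 w := by
    have hu1 : ∀ x ∈ u, 1 < x := fun x hx => by
      have := hu x hx
      have := hp.1.pos hx
      omega
    refine ⟨u.map (· - 1), ?_, hp.1.map_sub (m := 0) hu1⟩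
    conv_lhs => rw [← List.map_id u]
    rw [List.map_map]
    refine List.map_congr_left fun x hx => ?_
    have := hu1 x hx
    simp only [id, Function.comp]
    omega
  rw [max_one_top_map] at hp
  -- A letter of the first factor recurring after the second `1` would form the crossing `1 x 1 x`.
  have hbig : ∀ x ∈ R, x = 1 ∨ top w + 1 < x := by
    intro x hx
    by_contra! hc
    obtain ⟨hx1, hx2⟩ := hc
    have := hp.2.pos hx
    have hmem : x - 1 ∈ w := hw.mem_of_le_top (by omega) (by omega)
    have hmem' : x ∈ w.map (· + 1) := List.mem_map.2 ⟨x - 1, hmem, by omega⟩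
    rcases hR with rfl | ⟨R', rfl⟩
    · simp at hx
    · have hx' : x ∈ R' := by simpa [hx1] using hx
      refine hπ.2 1 x (by omega) ?_
      have := (List.singleton_sublist.2 hmem').append
        ((List.singleton_sublist.2 hx').cons_cons 1)
      exact this.cons_cons 1
  obtain ⟨r, rfl⟩ : ∃ r : List ℕ, R = r.map (sh (top w)) := by
    refine ⟨R.map fun x => if x ≤ 1 then x else x - top w, ?_⟩
    conv_lhs => rw [← List.map_id R]
    rw [List.map_map]
    refine List.map_congr_left fun x hx => ?_
    have := hbig x hx
    simp only [id, Function.comp, sh]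
    split_ifs <;> omega
  have hr : Rgf 0 r := by
    cases r with
    | nil => trivial
    | cons a r =>
      obtain ⟨_, e⟩ := hR.resolve_left (by simp)
      obtain ⟨e, -⟩ := List.cons.inj e
      obtain rfl : a = 1 := (sh_strictMono _).injective (e.trans (sh_one _).symm)
      refine ⟨by omega, ?_⟩
      have := hp.2.2
      rw [sh_one, max_eq_left (by omega), add_comm] at this
      exact (rgf_map_sh le_rfl).1 this
  exact ⟨w, r, .of_map (fun _ _ h => Nat.add_lt_add_right h 1) hw hπ (left_sublist_glue w r),
    .of_map (sh_strictMono _) hr hπ (right_sublist_glue w r), rfl⟩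

/-- A nonempty overhang `z` would start with the initial `1` of `r'`, yet its letters come from the
shifted `w` and exceed `1`. -/
theorem glue_aux {w w' r r' : List ℕ} (hw : Rgf 0 w) (hr' : Rgf 0 r') {z : List ℕ}
    (h1 : w.map (· + 1) = w'.map (· + 1) ++ z)
    (h2 : r'.map (sh (top w')) = z ++ r.map (sh (top w))) : z = [] := by
  cases z with
  | nil => rfl
  | cons c z =>
    obtain ⟨r'', rfl, -⟩ := hr'.eq_cons (by rintro rfl; simp at h2)
    obtain ⟨rfl, -⟩ := List.cons.inj h2
    have := one_lt_of_mem hw (x := sh (top w') 1) (by simp [h1])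
    simp [sh_one] at this

theorem glue_inj {w w' r r' : List ℕ} (hw : Rgf 0 w) (hw' : Rgf 0 w') (hr : Rgf 0 r)
    (hr' : Rgf 0 r') (h : glue w r = glue w' r') : w = w' ∧ r = r' := by
  have key : w.map (· + 1) = w'.map (· + 1) ∧ r.map (sh (top w)) = r'.map (sh (top w')) := by
    rcases List.append_eq_append_iff.1 (List.cons.inj h).2 with ⟨z, h1, h2⟩ | ⟨z, h1, h2⟩
    · obtain rfl := glue_aux hw' hr h1 h2
      exact ⟨by simpa using h1.symm, by simpa using h2⟩
    · obtain rfl := glue_aux hw hr' h1 h2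
      exact ⟨by simpa using h1, by simpa using h2.symm⟩
  obtain rfl : w = w' := List.map_injective_iff.2 (add_left_injective 1) key.1
  exact ⟨rfl, List.map_injective_iff.2 (sh_strictMono _).injective key.2⟩

/-! ### Lists of factors -/

/-- The word `1[w₁]1[w₂]⋯1[wₖ]`, up to renumbering of the blocks. -/
def join (L : List (List ℕ)) : List ℕ := L.foldr glue []

theorem join_cons (w : List ℕ) (L : List (List ℕ)) : join (w :: L) = glue w (join L) := rfl

theorem length_glue (w r : List ℕ) : (glue w r).length = w.length + 1 + r.length := by
  simp [glue]; omega

theorem length_join (L : List (List ℕ)) :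
    (join L).length = (L.map fun w => w.length + 1).sum := by
  induction L with
  | nil => rfl
  | cons w L ih => simp [join_cons, length_glue, ih]

theorem nc_join {L : List (List ℕ)} (hL : ∀ w ∈ L, NC w) : NC (join L) := by
  induction L with
  | nil => exact ⟨trivial, by simp [join]⟩
  | cons w L ih => exact nc_glue (hL w (by simp)) (ih fun w hw => hL w (by simp [hw]))

theorem NC.exists_join {π : List ℕ} (hπ : NC π) : ∃ L, (∀ w ∈ L, NC w) ∧ π = join L := by
  induction h : π.length using Nat.strong_induction_on generalizing π with
  | _ n ih =>
    by_cases h0 : π = []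
    · exact ⟨[], by simp, h0⟩
    obtain ⟨w, r, hw, hr, rfl⟩ := hπ.exists_glue h0
    obtain ⟨L, hL, rfl⟩ := ih r.length (by rw [length_glue] at h; omega) hr rfl
    exact ⟨w :: L, by simpa using ⟨hw, hL⟩, rfl⟩

theorem join_inj {L L' : List (List ℕ)} (hL : ∀ w ∈ L, NC w) (hL' : ∀ w ∈ L', NC w)
    (h : join L = join L') : L = L' := by
  induction L generalizing L' with
  | nil =>
    cases L' with
    | nil => rfl
    | cons w' L' => simp [join, glue] at h
  | cons w L ih =>
    cases L' with
    | nil => simp [join, glue] at h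
    | cons w' L' =>
      simp only [List.forall_mem_cons] at hL hL'
      obtain ⟨rfl, h'⟩ := glue_inj hL.1.1 hL'.1.1 (nc_join hL.2).1 (nc_join hL'.2).1 h
      rw [ih hL.2 hL'.2 h']

theorem join_contains_cons_iff {τ : List ℕ} (hτ : IsPartition τ) (hc : Linked τ)
    {L : List (List ℕ)} (hL : ∀ w ∈ L, NC w) :
    Contains (join L) (bracket [1] τ) ↔ ∃ w ∈ L, Contains w τ := by
  induction L with
  | nil =>
    rw [contains_iff]
    simp [join, occ_cons_iff hτ]
  | cons w L ih =>
    simp only [List.forall_mem_cons] at hL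
    rw [join_cons, glue_contains_cons_iff hτ hc hL.1.1 (nc_join hL.2).1, ih hL.2]
    simp

/-- Order matters only through the pairwise condition, so reversal of `L` can exchange `σ` and `τ`.
-/
theorem join_avoids_iff {σ τ : List ℕ} (hσ : IsPartition σ) (hτ : IsPartition τ)
    (hσc : Linked σ) (hτc : Linked τ) {L : List (List ℕ)} (hL : ∀ w ∈ L, NC w) :
    ¬ Contains (join L) (oneOne σ τ) ↔ (∀ w ∈ L, ¬ Contains w (oneOne σ τ)) ∧
      L.Pairwise fun w w' => ¬ (Contains w σ ∧ Contains w' τ) := by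
  induction L with
  | nil =>
    rw [contains_iff]
    simp [join, occ_oneOne_iff hσ hτ]
  | cons w L ih =>
    simp only [List.forall_mem_cons] at hL
    rw [join_cons, glue_contains_oneOne_iff hσ hτ hσc hτc hL.1.1 (nc_join hL.2).1,
      join_contains_cons_iff hτ hτc hL.2]
    simp only [not_or, ih hL.2, List.forall_mem_cons, List.pairwise_cons]
    push Not
    constructor
    · rintro ⟨h1, ⟨h2, h3⟩, h4⟩
      exact ⟨⟨h1, h2⟩, fun v hv h => h4 h v hv, h3⟩
    · rintro ⟨⟨h1, h2⟩, h4, h3⟩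
      exact ⟨h1, ⟨h2, h3⟩, fun h v hv => h4 v hv h⟩

/-! ### Comparing the numbers of avoiders -/

theorem map_injOn {α β : Type*} {f : α → β} {l l' : List α}
    (hf : ∀ x ∈ l, ∀ y ∈ l', f x = f y → x = y) (h : l.map f = l'.map f) : l = l' := by
  induction l generalizing l' with
  | nil => simpa using h.symm
  | cons a l ih =>
    cases l' with
    | nil => simp at h
    | cons b l' =>
      obtain ⟨h1, h2⟩ := List.cons.inj h
      rw [hf a (by simp) b (by simp) h1,
        ih (fun x hx y hy => hf x (by simp [hx]) y (by simp [hy])) h2]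

/-- An inequality between the numbers of avoiders is realised by an injection that preserves
containment of `σ` and of `τ`, since a partition not containing both avoids both patterns. -/
theorem exists_injection {σ τ : List ℕ} (hσ : IsPartition σ) (hτ : IsPartition τ) {n : ℕ}
    (h : (avoiders n {[1, 2, 1, 2], oneOne σ τ}).ncard ≤
      (avoiders n {[1, 2, 1, 2], oneOne τ σ}).ncard) :
    ∃ f : List ℕ → List ℕ, Set.InjOn f (avoiders n {[1, 2, 1, 2], oneOne σ τ}) ∧
      ∀ w ∈ avoiders n {[1, 2, 1, 2], oneOne σ τ}, f w ∈ avoiders n {[1, 2, 1, 2], oneOne τ σ} ∧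
        (Contains (f w) σ ↔ Contains w σ) ∧ (Contains (f w) τ ↔ Contains w τ) := by
  classical
  set A := avoiders n {[1, 2, 1, 2], oneOne σ τ}
  set A' := avoiders n {[1, 2, 1, 2], oneOne τ σ}
  let B : Set (List ℕ) := {w | Contains w σ ∧ Contains w τ}
  have hA : A.Finite := avoiders_finite _ _
  have hA' : A'.Finite := avoiders_finite _ _
  -- Outside `B` neither long pattern can occur, so the two classes agree there and only their parts
  -- in `B` need comparing.
  have e : A \ B = A' \ B := by
    ext w
    simp only [A, A', B, Set.mem_sdiff, mem_avoiders_iff, Set.mem_ofPred_eq]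
    have h1 := contains_of_oneOne (π := w) hσ hτ
    have h2 := contains_of_oneOne (π := w) hτ hσ
    tauto
  have h1 := Set.ncard_inter_add_ncard_sdiff_eq_ncard A B hA
  have h2 := Set.ncard_inter_add_ncard_sdiff_eq_ncard A' B hA'
  have h3 : (A ∩ B).ncard ≤ (A' ∩ B).ncard := by rw [← e] at h2; omega
  have f1 := hA.inter_of_left B
  have f2 := hA'.inter_of_left B
  obtain ⟨g, hg, hgi⟩ := f1.exists_injOn_of_encard_le (t := A' ∩ B) (by
    rw [← f1.cast_ncard_eq, ← f2.cast_ncard_eq]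
    exact_mod_cast h3)
  refine ⟨fun w => if w ∈ B then g w else w, ?_, ?_⟩
  · intro w hw v hv hwv
    by_cases bw : w ∈ B <;> by_cases bv : v ∈ B <;> simp only [bw, bv, if_true, if_false] at hwv
    · exact hgi ⟨hw, bw⟩ ⟨hv, bv⟩ hwv
    · exact absurd (hwv ▸ (hg ⟨hw, bw⟩).2) bv
    · exact absurd (hwv ▸ (hg ⟨hv, bv⟩).2) bw
    · exact hwv
  · intro w hw
    by_cases bw : w ∈ B <;> simp only [bw, if_true, if_false]
    · obtain ⟨h4, h5, h6⟩ := hg ⟨hw, bw⟩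
      exact ⟨h4, iff_of_true h5 bw.1, iff_of_true h6 bw.2⟩
    · have : w ∈ A' \ B := e ▸ ⟨hw, bw⟩
      exact ⟨this.1, trivial, trivial⟩

/-- Each factor is shorter than the whole because its `1` is counted separately, so the induction
supplies the replacement maps. -/
theorem ncard_avoiders_le {σ τ : List ℕ} (hσ : IsPartition σ) (hτ : IsPartition τ)
    (hσc : Linked σ) (hτc : Linked τ) (n : ℕ) :
    (avoiders n {[1, 2, 1, 2], oneOne σ τ}).ncard ≤
      (avoiders n {[1, 2, 1, 2], oneOne τ σ}).ncard := by
  induction n using Nat.strong_induction_on with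
  | _ n ih =>
    choose! f hfi hf using fun m hm => exists_injection hσ hτ (ih m hm)
    -- The injections for the various sizes combine into one, still injective because each preserves
    -- length.
    let F : List ℕ → List ℕ := fun w => f w.length w
    have hF : ∀ w, w.length < n → NC w → ¬ Contains w (oneOne σ τ) → NC (F w) ∧
        (F w).length = w.length ∧ ¬ Contains (F w) (oneOne τ σ) ∧
        (Contains (F w) σ ↔ Contains w σ) ∧ (Contains (F w) τ ↔ Contains w τ) := by
      intro w hw h1 h2
      obtain ⟨h3, h4⟩ := hf w.length hw w (mem_avoiders_iff.2 ⟨h1, rfl, h2⟩)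
      obtain ⟨h5, h6, h7⟩ := mem_avoiders_iff.1 h3
      exact ⟨h5, h6, h7, h4⟩
    have hFi : ∀ w v, w.length < n → NC w → ¬ Contains w (oneOne σ τ) → v.length < n → NC v →
        ¬ Contains v (oneOne σ τ) → F w = F v → w = v := by
      intro w v hw w1 w2 hv v1 v2 e
      have hl : w.length = v.length := by
        rw [← (hF w hw w1 w2).2.1, ← (hF v hv v1 v2).2.1, e]
      refine hfi w.length hw (mem_avoiders_iff.2 ⟨w1, rfl, w2⟩)
        (mem_avoiders_iff.2 ⟨v1, hl.symm, v2⟩) ?_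
      simpa only [F, hl] using e
    let S : Set (List (List ℕ)) := {L | (∀ w ∈ L, NC w) ∧ (join L).length = n ∧
      ¬ Contains (join L) (oneOne σ τ)}
    have hS : ∀ L ∈ S, ∀ w ∈ L, w.length < n ∧ NC w ∧ ¬ Contains w (oneOne σ τ) := by
      rintro L ⟨h1, h2, h3⟩ w hw
      refine ⟨?_, h1 w hw, ((join_avoids_iff hσ hτ hσc hτc h1).1 h3).1 w hw⟩
      rw [length_join] at h2
      have := List.single_le_sum (l := L.map fun w => w.length + 1) (by simp) _
        (List.mem_map_of_mem hw)
      omega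
    have hSA : join '' S = avoiders n {[1, 2, 1, 2], oneOne σ τ} := by
      ext π
      rw [mem_avoiders_iff]
      constructor
      · rintro ⟨L, ⟨h1, h2, h3⟩, rfl⟩
        exact ⟨nc_join h1, h2, h3⟩
      · rintro ⟨h1, h2, h3⟩
        obtain ⟨L, hL, rfl⟩ := h1.exists_join
        exact ⟨L, ⟨hL, h2, h3⟩, rfl⟩
    have hinj : Set.InjOn join S := fun L hL L' hL' h => join_inj hL.1 hL'.1 h
    rw [← hSA, hinj.ncard_image]
    have hnc : ∀ L ∈ S, ∀ w ∈ (L.map F).reverse, NC w := by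
      intro L hL w hw
      obtain ⟨v, hv, rfl⟩ := List.mem_map.1 (List.mem_reverse.1 hw)
      obtain ⟨h1, h2, h3⟩ := hS L hL v hv
      exact (hF v h1 h2 h3).1
    refine Set.ncard_le_ncard_of_injOn (fun L => join (L.map F).reverse) ?_ ?_
      (avoiders_finite _ _)
    · intro L hL
      refine mem_avoiders_iff.2 ⟨nc_join (hnc L hL), ?_, ?_⟩
      · rw [← hL.2.1, length_join, length_join, List.map_reverse, List.sum_reverse, List.map_map]
        congr 1
        refine List.map_congr_left fun w hw => ?_
        obtain ⟨h1, h2, h3⟩ := hS L hL w hw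
        simp [(hF w h1 h2 h3).2.1]
      · rw [join_avoids_iff hτ hσ hτc hσc (hnc L hL)]
        constructor
        · intro w hw
          obtain ⟨v, hv, rfl⟩ := List.mem_map.1 (List.mem_reverse.1 hw)
          obtain ⟨h1, h2, h3⟩ := hS L hL v hv
          exact (hF v h1 h2 h3).2.2.1
        -- Reversal turns "no `τ` before `σ`" among the new factors into "no `σ` before `τ`" among
        -- the old ones.
        · rw [List.pairwise_reverse, List.pairwise_map]
          refine ((join_avoids_iff hσ hτ hσc hτc hL.1).1 hL.2.2).2.imp_of_mem ?_
          intro w v hw hv h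
          obtain ⟨w1, w2, w3⟩ := hS L hL w hw
          obtain ⟨v1, v2, v3⟩ := hS L hL v hv
          rw [(hF w w1 w2 w3).2.2.2.1, (hF v v1 v2 v3).2.2.2.2]
          tauto
    · intro L hL L' hL' h
      have e : L.map F = L'.map F :=
        List.reverse_injective (join_inj (hnc L hL) (hnc L' hL') h)
      refine map_injOn (fun w hw v hv => ?_) e
      obtain ⟨w1, w2, w3⟩ := hS L hL w hw
      obtain ⟨v1, v2, v3⟩ := hS L' hL' v hv
      exact hFi w v w1 w2 w3 v1 v2 v3

end SetPart

theorem mainTheorem10 (σ τ : List ℕ)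
    (hσ : SetPart.IsPartition σ) (hτ : SetPart.IsPartition τ)
    (hσc : SetPart.Connected σ) (hτc : SetPart.Connected τ) :
    SetPart.NCEquiv (SetPart.oneOne σ τ) (SetPart.oneOne τ σ) := by
  have h1 : SetPart.Linked σ := fun _ _ e hu hv => hσc.exists_common hσ e hu hv
  have h2 : SetPart.Linked τ := fun _ _ e hu hv => hτc.exists_common hτ e hu hv
  intro n
  exact le_antisymm (SetPart.ncard_avoiders_le hσ hτ h1 h2 n)
    (SetPart.ncard_avoiders_le hτ hσ h2 h1 n)
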